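/- Let $K$ be an abstract simplicial complex (not necessarily finite) and let $n\ge 1$. Let $K^n$ be the $n$-fold categorical product of $K$: its vertices are the $n$-tuples of vertices of $K$, and a nonempty finite set of such tuples is a simplex if and only if each of its $n$ coordinate projections is a simplex of $K$. Two simplicial maps $\varphi,\psi:L\to M$ are \emph{contiguous} if $\varphi(s)\cup\psi(s)$ is a simplex of $M$ for every simplex $s$ of $L$, and are in the same \emph{contiguity class} if they are joined by a finite sequence of simplicial maps $L\to M$ in which consecutive maps are contiguous. A subcomplex $\Omega\subset K^n$ is \emph{$n$-Farber} if there is a simplicial map $\sigma:\Omega\to K$ such that $\Delta\circ\sigma$ and the inclusion $\Omega\hookrightarrow K^n$ are in the same contiguity class, where $\Delta:K\to K^n$, $\Delta(v)=(v,\dots,v)$. The $n$-th discrete topological complexity $\mathrm{TC}_n(K)\in\{0,1,2,\dots\}\cup\{\infty\}$ is the least $k\ge 0$ such that $K^n$ is the union of $k+1$ $n$-Farber subcomplexes ($\infty$ if there is no such $k$). For a topological space $X$, let $X^{J_n}$ be the space, with the compact-open topology, of continuous maps to $X$ from the wedge $J_n$ of $n$ unit intervals glued at $0$ (that is, of $n$-tuples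 of paths in $X$ with a common starting point), and let $e_n:X^{J_n}\to X^n$ be evaluation at the $n$ free endpoints. Rudyak's $n$-th topological complexity $\mathrm{TC}_n(X)$ is the least $k\ge 0$ such that $X^n$ has a cover by $k+1$ open sets over each of which $e_n$ has a continuous section ($\infty$ if there is no such $k$). Then, for the geometric realisation $|K|$ of $K$ (with the weak topology), $$\mathrm{TC}_n(|K|)\le \mathrm{TC}_n(K).$$ -/

import Mathlib

open scoped unitInterval

/-! ### Simplicial maps, contiguity, subcomplexes -/

section Simplicial

universe u v w

open Classical in
/-- A simplicial map between abstract simplicial complexes: a map of vertices that sends faces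
to faces. -/
@[ext]
structure SimplicialMap {V : Type u} {W : Type v}
    (K : AbstractSimplicialComplex V) (L : AbstractSimplicialComplex W) where
  /-- the map on vertices -/
  toFun : V → W
  map_face : ∀ s : Finset V, s ∈ K → s.image toFun ∈ L

/-- Composition of simplicial maps. -/
def SimplicialMap.comp {V : Type u} {W : Type v} {X : Type w}
    {K : AbstractSimplicialComplex V} {L : AbstractSimplicialComplex W}
    {M : AbstractSimplicialComplex X} (g : SimplicialMap L M) (f : SimplicialMap K L) :
    SimplicialMap K M where
  toFun := g.toFun ∘ f.toFun
  map_face s hs := by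
    classical
    have h := g.map_face _ (f.map_face s hs)
    rwa [Finset.image_image] at h

open Classical in
/-- Two simplicial maps `f, g : K → L` are contiguous if `f(s) ∪ g(s)` is a face of `L` for every
face `s` of `K`. -/
def Contiguous {V : Type u} {W : Type v}
    {K : AbstractSimplicialComplex V} {L : AbstractSimplicialComplex W}
    (f g : SimplicialMap K L) : Prop :=
  ∀ s : Finset V, s ∈ K → s.image f.toFun ∪ s.image g.toFun ∈ L

/-- Two simplicial maps are in the same contiguity class if they are joined by a finite sequence
of simplicial maps in which consecutive maps are contiguous. -/
def SameContiguityClass {V : Type u} {W : Type v}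
    {K : AbstractSimplicialComplex V} {L : AbstractSimplicialComplex W}
    (f g : SimplicialMap K L) : Prop :=
  Relation.ReflTransGen (fun a b : SimplicialMap K L => Contiguous a b) f g

/-- A downward closed family `Ω` of nonempty finite sets, regarded as an abstract simplicial complex
on its own vertex set `{v | {v} ∈ Ω}`. Used for subcomplexes, which need not contain every vertex
of the ambient complex. -/
def PreAbstractSimplicialComplex.toComplex {V : Type u} (Ω : PreAbstractSimplicialComplex V) :
    AbstractSimplicialComplex {v : V // {v} ∈ Ω} where
  faces := {s | s.map (Function.Embedding.subtype _) ∈ Ω}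
  isRelLowerSet_faces := by
    intro s hs
    refine ⟨Finset.map_nonempty.1 (Ω.isRelLowerSet_faces hs).1, fun t hts ht => ?_⟩
    exact (Ω.isRelLowerSet_faces hs).2 (Finset.map_subset_map.2 hts) (Finset.map_nonempty.2 ht)
  singleton_mem v := by
    have h : ({v} : Finset {v : V // {v} ∈ Ω}).map (Function.Embedding.subtype _) = {v.1} := by
      simp
    change _ ∈ Ω
    rw [h]
    exact v.2

/-- The inclusion of a subcomplex `Ω` into the ambient complex `K`. -/
def subcomplexInclusion {V : Type u} {Ω : PreAbstractSimplicialComplex V}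
    {K : AbstractSimplicialComplex V} (h : Ω ≤ K.toPreAbstractSimplicialComplex) :
    SimplicialMap Ω.toComplex K where
  toFun v := v.1
  map_face s hs := by
    classical
    have hs' : s.map (Function.Embedding.subtype _) ∈ Ω := hs
    rw [Finset.map_eq_image] at hs'
    convert! h hs' using 1

open Classical in
/-- The `n`-fold categorical power `K ^ n`: its vertices are the `n`-tuples of vertices of `K`, and
a nonempty finite set of `n`-tuples is a face when all its coordinate projections are faces
of `K`. -/
def AbstractSimplicialComplex.power {V : Type u} (K : AbstractSimplicialComplex V) (n : ℕ) :
    AbstractSimplicialComplex (Fin n → V) where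
  faces := {s | s.Nonempty ∧ ∀ i, s.image (fun x => x i) ∈ K}
  isRelLowerSet_faces := by
    intro s hs
    refine ⟨hs.1, fun t hts ht => ⟨ht, fun i => ?_⟩⟩
    exact (K.isRelLowerSet_faces (hs.2 i)).2 (Finset.image_subset_image hts) (ht.image _)
  singleton_mem v := by
    refine ⟨Finset.singleton_nonempty v, fun i => ?_⟩
    rw [Finset.image_singleton]
    exact K.singleton_mem (v i)

/-- The diagonal simplicial map `Δ : K → K ^ n`, `v ↦ (v, …, v)`. -/
def diagonalMap {V : Type u} (K : AbstractSimplicialComplex V) (n : ℕ) :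
    SimplicialMap K (K.power n) where
  toFun v := fun _ => v
  map_face s hs := by
    classical
    refine ⟨by simpa using (K.isRelLowerSet_faces hs).1, fun i => ?_⟩
    convert! hs
    ext v
    simp

/-- `Ω` is an `n`-Farber subcomplex of `K ^ n`: it is a subcomplex, and there is a simplicial map
`τ : Ω → K` such that `Δ ∘ τ` and the inclusion `Ω ↪ K ^ n` are in the same contiguity class. -/
def IsFarberSubcomplex {V : Type u} (K : AbstractSimplicialComplex V) (n : ℕ)
    (Ω : PreAbstractSimplicialComplex (Fin n → V)) : Prop :=
  ∃ (h : Ω ≤ (K.power n).toPreAbstractSimplicialComplex) (τ : SimplicialMap Ω.toComplex K),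
    SameContiguityClass ((diagonalMap K n).comp τ) (subcomplexInclusion h)

/-- The `n`-th discrete topological complexity: the least `k` such that `K ^ n` is a union of
`k + 1` `n`-Farber subcomplexes (`⊤` if there is no such `k`). -/
noncomputable def discreteTC {V : Type u} (K : AbstractSimplicialComplex V) (n : ℕ) : ℕ∞ :=
  ⨅ (k : ℕ) (_ : ∃ Ω : Fin (k + 1) → PreAbstractSimplicialComplex (Fin n → V),
      (∀ j, IsFarberSubcomplex K n (Ω j)) ∧ ∀ s ∈ K.power n, ∃ j, s ∈ Ω j), (k : ℕ∞)

/-! ### Geometric realisation -/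

/-- The closed simplex spanned by a finite set `s` of vertices, in barycentric coordinates. As a
subspace of `V → ℝ` it carries the Euclidean topology. -/
def closedSimplex {V : Type u} (s : Finset V) : Set (V → ℝ) :=
  {x | (∀ v, 0 ≤ x v) ∧ (∀ v, v ∉ s → x v = 0) ∧ ∑ v ∈ s, x v = 1}

/-- The geometric realisation `|K|`: the union of the closed simplices of the faces of `K`, in
barycentric coordinates. -/
@[ext]
structure GeometricRealization {V : Type u} (K : AbstractSimplicialComplex V) where
  /-- the barycentric coordinates -/
  coord : V → ℝ
  exists_face : ∃ s ∈ K, coord ∈ closedSimplex s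

/-- The inclusion of the closed simplex of a face into the realisation. -/
def simplexInclusion {V : Type u} {K : AbstractSimplicialComplex V} (s : {s : Finset V // s ∈ K})
    (x : closedSimplex s.1) : GeometricRealization K :=
  ⟨x.1, s.1, s.2, x.2⟩

/-- The weak (coherent) topology on `|K|`: a set is open (closed) iff its intersection with each
closed simplex is open (closed) in that simplex. -/
instance {V : Type u} (K : AbstractSimplicialComplex V) :
    TopologicalSpace (GeometricRealization K) :=
  ⨆ s : {s : Finset V // s ∈ K}, TopologicalSpace.coinduced (simplexInclusion s) inferInstance

end Simplicial

/-! ### Higher topological complexity -/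

section Topological

universe u v

/-- The (normalised) Schwarz genus of `p : E → B`: the least `k` such that `B` is covered by `k + 1`
open sets over each of which `p` has a continuous section (`⊤` if there is no such `k`). -/
noncomputable def schwarzGenus {E : Type u} {B : Type v} [TopologicalSpace E] [TopologicalSpace B]
    (p : E → B) : ℕ∞ :=
  ⨅ (k : ℕ) (_ : ∃ U : Fin (k + 1) → Set B, (∀ j, IsOpen (U j)) ∧ (⋃ j, U j) = Set.univ ∧
      ∀ j, ∃ s : C(U j, E), ∀ b : U j, p (s b) = b), (k : ℕ∞)

/-- The space `X ^ (J n)` of continuous maps to `X` from the wedge `J n` of `n ≥ 1` unit intervals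
glued at `0`: such a map is an `n`-tuple of paths in `X` with a common starting point. It carries
the compact-open topology. -/
abbrev WedgePathSpace (n : ℕ) (X : Type u) [TopologicalSpace X] : Type u :=
  {γ : Fin n → C(I, X) // ∀ i j, γ i 0 = γ j 0}

/-- Rudyak's fibration `X ^ (J n) → X ^ n`, evaluation at the `n` free endpoints. -/
def endpointMap (n : ℕ) (X : Type u) [TopologicalSpace X] (γ : WedgePathSpace n X) : Fin n → X :=
  fun i => γ.1 i 1

/-- Rudyak's `n`-th topological complexity of a space (normalised, so that it is `0` for
contractible spaces). -/
noncomputable def topologicalTC (n : ℕ) (X : Type u) [TopologicalSpace X] : ℕ∞ :=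
  schwarzGenus (endpointMap n X)

end Topological

/-!
The weak topology on `|K|` and the product topology on `|K| ^ n` only fit together through locally
finite families. A partition of unity on a space `Z`, indexed by the vertices of `K` and with all
pointwise supports faces of `K`, is the same as barycentric coordinates of a map `Z → |K|`, and
local finiteness makes this map continuous (`GeometricRealization.ofPartition`). Two such maps are
homotopic along segments as soon as their pointwise supports span faces
(`GeometricRealization.homotopic_ofPartition`), so contiguous maps give homotopic ones
(`SameContiguityClass.homotopic`).

The barycentric coordinates of `|K|` itself are not locally finite. Cutting off the small ones makes
them so, without changing the identity map up to homotopy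
(`GeometricRealization.homotopic_ofPartition_truncatedCoord_id`). The products of the truncated
coordinates form a partition of unity on `|K| ^ n`, continuous for the product topology, whose
pointwise supports are faces of `K ^ n` (`powerPartition`); it plays the role of a map
`|K| ^ n → |K ^ n|`.

For a subcomplex `Ω` of `K ^ n`, let `c` be the sum over all nonempty finite sets that are not in `Ω`
of the smallest coordinate on the set. It is continuous, it vanishes on `Ω`, and the vertices whose
coordinate exceeds `c` form a face of `Ω` if there are any. Hence the set where some coordinate
exceeds `c` is an open neighbourhood of `Ω`, and subtracting `c` from the coordinates retracts it to
`Ω`. If `Ω` is Farber, with `τ : Ω → K`, the retraction followed by `τ` is homotopic to each of the `n`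
projections of this neighbourhood to `|K|`: the contiguity class leads from `Δ ∘ τ` to the inclusion,
and two segment homotopies undo the retraction and the truncation
(`IsFarberSubcomplex.exists_homotopic`). These `n` homotopies with a common start are a section of the
endpoint map. The neighbourhoods belonging to subcomplexes that cover `K ^ n` cover `|K| ^ n`.
-/

/-! ### Operations on partitions of unity -/

section Partitions

open Set Function Topology Filter

theorem locallyFinite_support_iff_eventually {A Z : Type*} [TopologicalSpace Z] {h : A → Z → ℝ} :
    LocallyFinite (fun a => support (h a)) ↔
      ∀ z, ∃ F : Finset A, ∀ᶠ y in 𝓝 z, ∀ a ∉ F, h a y = 0 := by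
  refine ⟨fun H z => ?_, fun H z => ?_⟩
  · obtain ⟨F, hF⟩ := H.exists_finset_support z
    exact ⟨F, hF.mono fun y hy a ha => by_contra fun h0 => ha (hy h0)⟩
  · obtain ⟨F, hF⟩ := H z
    refine ⟨_, hF, F.finite_toSet.subset ?_⟩
    rintro a ⟨y, hy, hy'⟩
    exact by_contra fun ha => hy (hy' a ha)

namespace PartitionOfUnity

variable {A B Z Y : Type*} [TopologicalSpace Z] [TopologicalSpace Y]

theorem exists_finset_eventually_eq_zero (p : PartitionOfUnity A Z) (z : Z) :
    ∃ F : Finset A, ∀ᶠ y in 𝓝 z, ∀ a ∉ F, p a y = 0 :=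
  locallyFinite_support_iff_eventually.1 p.locallyFinite z

/-- The partition of unity obtained from a family `h` by cutting off everything below the level `c`
and normalising: its members are the functions `max (h a - c) 0` divided by their sum. -/
noncomputable def truncate (h : A → C(Z, ℝ)) (c : C(Z, ℝ))
    (hf : LocallyFinite fun a => {z | c z < h a z}) (hpos : ∀ z, ∃ a, c z < h a z) :
    PartitionOfUnity A Z := by
  have hfin : LocallyFinite fun a => support fun z => max (h a z - c z) 0 :=
    hf.subset fun a z hz => by
      by_contra hlt
      exact hz (max_eq_right (sub_nonpos.2 (not_lt.1 hlt)))
  have hS : ∀ z, 0 < ∑ᶠ b, max (h b z - c z) 0 := fun z => by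
    obtain ⟨a, ha⟩ := hpos z
    refine finsum_pos (fun b => le_max_right _ _) ⟨a, lt_max_of_lt_left (sub_pos.2 ha)⟩
      (hfin.point_finite z)
  have hsum : ∀ z, ∑ᶠ a, max (h a z - c z) 0 / ∑ᶠ b, max (h b z - c z) 0 = 1 := fun z => by
    simp_rw [div_eq_mul_inv]
    rw [← finsum_mul, mul_inv_cancel₀ (hS z).ne']
  exact
  { toFun := fun a => ⟨fun z => max (h a z - c z) 0 / ∑ᶠ b, max (h b z - c z) 0,
      Continuous.div (by fun_prop)
        (continuous_finsum (fun b => by fun_prop) hfin) fun z => (hS z).ne'⟩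
    locallyFinite' := hfin.subset fun a z hz h0 => hz (by
      change max (h a z - c z) 0 = 0 at h0
      simp [h0])
    nonneg' := fun a z => div_nonneg (le_max_right _ _) (hS z).le
    sum_eq_one' := fun z _ => hsum z
    sum_le_one' := fun z => (hsum z).le }

theorem lt_of_truncate_ne_zero {h : A → C(Z, ℝ)} {c : C(Z, ℝ)}
    {hf : LocallyFinite fun a => {z | c z < h a z}} {hpos : ∀ z, ∃ a, c z < h a z} {a : A} {z : Z}
    (ha : truncate h c hf hpos a z ≠ 0) : c z < h a z := by
  by_contra hlt
  refine ha ?_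
  change max (h a z - c z) 0 / _ = 0
  rw [max_eq_right (sub_nonpos.2 (not_lt.1 hlt)), zero_div]

/-- The pullback of a partition of unity along a continuous map. -/
def compContinuous (p : PartitionOfUnity A Z) (g : C(Y, Z)) : PartitionOfUnity A Y where
  toFun a := (p a).comp g
  locallyFinite' := p.locallyFinite.preimage_continuous g.continuous
  nonneg' a y := p.nonneg a (g y)
  sum_eq_one' y _ := p.sum_eq_one (mem_univ (g y))
  sum_le_one' y := p.sum_le_one (g y)

@[simp]
theorem compContinuous_apply (p : PartitionOfUnity A Z) (g : C(Y, Z)) (a : A) (y : Y) :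
    p.compContinuous g a y = p a (g y) := rfl

@[simp]
theorem finsupport_compContinuous (p : PartitionOfUnity A Z) (g : C(Y, Z)) (y : Y) :
    (p.compContinuous g).finsupport y = p.finsupport (g y) := by
  ext a
  simp

theorem sum_fiber_eq_finsum [DecidableEq B] (p : PartitionOfUnity A Z) (f : A → B) (b : B) (z : Z) :
    ∑ᶠ (a) (_ : f a = b), p a z = ∑ a ∈ p.finsupport z with f a = b, p a z := by
  refine finsum_mem_eq_sum_of_inter_support_eq (s := {a | f a = b}) _ ?_
  ext a
  simp only [mem_inter_iff, mem_support, Finset.coe_filter, mem_finsupport, mem_ofPred_eq]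
  tauto

/-- The pushforward of a partition of unity along a map of index sets: the functions whose indices
have the same image are added up. -/
noncomputable def mapIndex (p : PartitionOfUnity A Z) (f : A → B) : PartitionOfUnity B Z := by
  classical
  have hsum : ∀ z, ∑ᶠ b, ∑ᶠ (a) (_ : f a = b), p a z = 1 := fun z => by
    simp only [sum_fiber_eq_finsum]
    rw [finsum_eq_sum_of_support_subset (s := (p.finsupport z).image f),
      Finset.sum_fiberwise_of_maps_to fun a ha => Finset.mem_image_of_mem f ha,
      p.sum_finsupport (mem_univ z)]
    intro b hb
    obtain ⟨a, ha, -⟩ := Finset.exists_ne_zero_of_sum_ne_zero hb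
    rw [Finset.mem_filter] at ha
    exact Finset.mem_coe.2 (Finset.mem_image.2 ⟨a, ha⟩)
  exact
  { toFun := fun b => ⟨fun z => ∑ᶠ (a) (_ : f a = b), p a z,
      continuous_finsum_cond (fun a _ => (p a).continuous) p.locallyFinite⟩
    locallyFinite' := by
      refine locallyFinite_support_iff_eventually.2 fun z => ?_
      obtain ⟨F, hF⟩ := p.exists_finset_eventually_eq_zero z
      refine ⟨F.image f, hF.mono fun y hy b hb => ?_⟩
      change ∑ᶠ (a) (_ : f a = b), p a y = 0
      refine finsum_mem_eq_zero_of_forall_eq_zero (s := {a | f a = b}) fun a ha => hy a fun haF => ?_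
      exact hb (Finset.mem_image.2 ⟨a, haF, ha⟩)
    nonneg' := fun b z => finsum_nonneg fun a => finsum_nonneg fun _ => p.nonneg a z
    sum_eq_one' := fun z _ => hsum z
    sum_le_one' := fun z => (hsum z).le }

theorem exists_of_mapIndex_ne_zero {p : PartitionOfUnity A Z} {f : A → B} {b : B} {z : Z}
    (hb : p.mapIndex f b z ≠ 0) : ∃ a, f a = b ∧ p a z ≠ 0 := by
  obtain ⟨a, ha, h0⟩ := exists_ne_zero_of_finsum_mem_ne_zero (s := {a | f a = b}) hb
  exact ⟨a, ha, h0⟩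

theorem finsupport_mapIndex_subset [DecidableEq B] (p : PartitionOfUnity A Z) (f : A → B) (z : Z) :
    (p.mapIndex f).finsupport z ⊆ (p.finsupport z).image f := by
  intro b hb
  obtain ⟨a, rfl, ha⟩ := exists_of_mapIndex_ne_zero ((mem_finsupport _ _).1 hb)
  exact Finset.mem_image_of_mem f ((mem_finsupport _ _).2 ha)

/-- The product of finitely many partitions of unity, indexed by tuples of indices. -/
noncomputable def pi {ι : Type*} [Fintype ι] (p : ι → PartitionOfUnity A Z) :
    PartitionOfUnity (ι → A) Z := by
  classical
  have hsum : ∀ z, ∑ᶠ a : ι → A, ∏ i, p i (a i) z = 1 := fun z => by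
    rw [finsum_eq_sum_of_support_subset (s := Fintype.piFinset fun i => (p i).finsupport z),
      ← Finset.prod_univ_sum _ fun i a => p i a z]
    · exact Finset.prod_eq_one fun i _ => (p i).sum_finsupport (mem_univ z)
    · intro a ha
      rw [Finset.mem_coe, Fintype.mem_piFinset]
      exact fun i => (mem_finsupport _ _).2 (Finset.prod_ne_zero_iff.1 ha i (Finset.mem_univ i))
  exact
  { toFun := fun a => ⟨fun z => ∏ i, p i (a i) z, by fun_prop⟩
    locallyFinite' := by
      refine locallyFinite_support_iff_eventually.2 fun z => ?_
      choose F hF using fun i => (p i).exists_finset_eventually_eq_zero z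
      refine ⟨Fintype.piFinset F, (eventually_all.2 hF).mono fun y hy a ha => ?_⟩
      obtain ⟨i, hi⟩ := not_forall.1 (mt Fintype.mem_piFinset.2 ha)
      exact Finset.prod_eq_zero (Finset.mem_univ i) (hy i _ hi)
    nonneg' := fun a z => Finset.prod_nonneg fun i _ => (p i).nonneg (a i) z
    sum_eq_one' := fun z _ => hsum z
    sum_le_one' := fun z => (hsum z).le }

theorem ne_zero_of_pi_ne_zero {ι : Type*} [Fintype ι] {p : ι → PartitionOfUnity A Z} {a : ι → A}
    {z : Z} (h : pi p a z ≠ 0) (i : ι) : p i (a i) z ≠ 0 :=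
  Finset.prod_ne_zero_iff.1 h i (Finset.mem_univ i)

/-- The linear interpolation between two partitions of unity on `Z`, as a partition of unity
on `I × Z`. -/
noncomputable def lerp (p q : PartitionOfUnity A Z) : PartitionOfUnity A (I × Z) := by
  have hsum : ∀ x : I × Z, ∑ᶠ a, ((1 - (x.1 : ℝ)) * p a x.2 + x.1 * q a x.2) = 1 := fun x => by
    have hp := p.locallyFinite.point_finite x.2
    have hq := q.locallyFinite.point_finite x.2
    rw [finsum_add_distrib (hp.subset (support_mul_subset_right _ _))
      (hq.subset (support_mul_subset_right _ _)), ← mul_finsum, ← mul_finsum,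
      p.sum_eq_one (mem_univ _), q.sum_eq_one (mem_univ _)]
    ring
  exact
  { toFun := fun a => ⟨fun x => (1 - (x.1 : ℝ)) * p a x.2 + x.1 * q a x.2, by fun_prop⟩
    locallyFinite' := by
      classical
      refine locallyFinite_support_iff_eventually.2 fun x => ?_
      obtain ⟨F, hF⟩ := p.exists_finset_eventually_eq_zero x.2
      obtain ⟨G, hG⟩ := q.exists_finset_eventually_eq_zero x.2
      refine ⟨F ∪ G, ((hF.and hG).prod_inr_nhds x.1).mono fun y hy a ha => ?_⟩
      rw [Finset.notMem_union] at ha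
      change (1 - (y.1 : ℝ)) * p a y.2 + y.1 * q a y.2 = 0
      rw [hy.1 a ha.1, hy.2 a ha.2, mul_zero, mul_zero, add_zero]
    nonneg' := fun a x => add_nonneg (mul_nonneg (sub_nonneg.2 x.1.2.2) (p.nonneg a x.2))
      (mul_nonneg x.1.2.1 (q.nonneg a x.2))
    sum_eq_one' := fun x _ => hsum x
    sum_le_one' := fun x => (hsum x).le }

theorem lerp_apply (p q : PartitionOfUnity A Z) (a : A) (t : I) (z : Z) :
    lerp p q a (t, z) = (1 - (t : ℝ)) * p a z + t * q a z := rfl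

theorem finsupport_lerp_subset [DecidableEq A] (p q : PartitionOfUnity A Z) (x : I × Z) :
    (lerp p q).finsupport x ⊆ p.finsupport x.2 ∪ q.finsupport x.2 := by
  intro a ha
  simp only [Finset.mem_union, mem_finsupport, mem_support] at ha ⊢
  contrapose! ha
  rw [lerp_apply, ha.1, ha.2, mul_zero, mul_zero, add_zero]

theorem finsupport_nonempty (p : PartitionOfUnity A Z) (z : Z) : (p.finsupport z).Nonempty := by
  obtain ⟨a, ha⟩ := p.exists_pos (mem_univ z)
  exact ⟨a, (p.mem_finsupport z).2 ha.ne'⟩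

end PartitionOfUnity

end Partitions

/-! ### Maps into the geometric realisation -/

section Realization

open Set Function Topology Filter

universe u

theorem AbstractSimplicialComplex.mem_of_subset {V : Type u} {K : AbstractSimplicialComplex V}
    {s t : Finset V} (hs : s ∈ K) (hts : t ⊆ s) (ht : t.Nonempty) : t ∈ K :=
  (K.isRelLowerSet_faces hs).2 hts ht

namespace GeometricRealization

variable {V : Type u} {K : AbstractSimplicialComplex V} {Y Z : Type*} [TopologicalSpace Y]
  [TopologicalSpace Z]

theorem continuous_simplexInclusion (s : {s : Finset V // s ∈ K}) :
    Continuous (simplexInclusion s) :=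
  continuous_iff_coinduced_le.2 (le_iSup
    (fun s : {s : Finset V // s ∈ K} => TopologicalSpace.coinduced (simplexInclusion s) _) s)

theorem continuous_iff {f : GeometricRealization K → Y} :
    Continuous f ↔ ∀ s : {s : Finset V // s ∈ K}, Continuous (f ∘ simplexInclusion s) :=
  continuous_iSup_dom.trans (forall_congr' fun _ => continuous_coinduced_dom)

theorem exists_eq_simplexInclusion (x : GeometricRealization K) :
    ∃ (s : {s : Finset V // s ∈ K}) (y : closedSimplex s.1), simplexInclusion s y = x := by
  obtain ⟨s, hs, hx⟩ := x.exists_face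
  exact ⟨⟨s, hs⟩, ⟨x.coord, hx⟩, rfl⟩

/-- The barycentric coordinates on a closed simplex, as a partition of unity. -/
noncomputable def simplexPartition (s : Finset V) : PartitionOfUnity V (closedSimplex s) := by
  have hsum : ∀ x : closedSimplex s, ∑ᶠ v, x.1 v = 1 := fun x => by
    rw [finsum_eq_sum_of_support_subset (s := s), x.2.2.2]
    exact fun v hv => by_contra fun h => hv (x.2.2.1 v h)
  exact
  { toFun := fun v => ⟨fun x => x.1 v, (continuous_apply v).comp continuous_subtype_val⟩
    locallyFinite' := locallyFinite_support_iff_eventually.2 fun _ =>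
      ⟨s, Eventually.of_forall fun y v hv => y.2.2.1 v hv⟩
    nonneg' := fun v x => x.2.1 v
    sum_eq_one' := fun x _ => hsum x
    sum_le_one' := fun x => (hsum x).le }

theorem finsupport_simplexPartition_subset (s : Finset V) (x : closedSimplex s) :
    (simplexPartition s).finsupport x ⊆ s := fun v hv =>
  by_contra fun h => (PartitionOfUnity.mem_finsupport _ _).1 hv (x.2.2.1 v h)

/-- The continuous map into `|K|` whose barycentric coordinates are the members of a partition of
unity. Local finiteness is what makes it continuous for the weak topology: near each point it runs
through finitely many closed simplices only. -/
noncomputable def ofPartition (p : PartitionOfUnity V Z) (hp : ∀ z, p.finsupport z ∈ K) :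
    C(Z, GeometricRealization K) where
  toFun z := ⟨fun v => p v z, p.finsupport z, hp z, fun v => p.nonneg v z,
    fun v hv => by simpa using hv, p.sum_finsupport (mem_univ z)⟩
  continuous_toFun := by
    have hmem : ∀ s : Finset V, ∀ z ∈ closure {z | p.finsupport z = s}, ∀ v ∉ s, p v z = 0 := by
      intro s z hz v hv
      refine closure_minimal (t := {z | p v z = 0}) ?_ (isClosed_eq (p v).continuous
        continuous_const) hz
      rintro y rfl
      simpa using hv
    have hlf : LocallyFinite fun s : Finset V => {z | p.finsupport z = s} := by
      intro z
      obtain ⟨F, hF⟩ := p.exists_finset_eventually_eq_zero z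
      refine ⟨_, hF, F.powerset.finite_toSet.subset ?_⟩
      rintro s ⟨y, rfl, hy⟩
      refine Finset.mem_coe.2 (Finset.mem_powerset.2 fun v hv => ?_)
      exact by_contra fun h => (p.mem_finsupport y).1 hv (hy v h)
    refine hlf.closure.continuous (iUnion_eq_univ_iff.2 fun z =>
      ⟨p.finsupport z, subset_closure rfl⟩) (fun _ => isClosed_closure) fun s => ?_
    rcases (closure {z | p.finsupport z = s}).eq_empty_or_nonempty with h | h
    · rw [h]
      exact continuousOn_empty _
    obtain ⟨z, hz⟩ := closure_nonempty_iff.1 h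
    have hs : s ∈ K := hz ▸ hp z
    rw [continuousOn_iff_continuous_domRestrict]
    have hmem' : ∀ y : closure {z | p.finsupport z = s}, (fun v => p v y) ∈ closedSimplex s :=
      fun y => ⟨fun v => p.nonneg v y, hmem s y y.2, p.sum_finsupport' (mem_univ _) fun v hv =>
        by_contra fun h => (p.mem_finsupport _).1 hv (hmem s y y.2 v h)⟩
    exact (continuous_simplexInclusion ⟨s, hs⟩).comp
      (f := fun y : closure {z | p.finsupport z = s} => ⟨fun v => p v y, hmem' y⟩) (by fun_prop)

@[simp]
theorem ofPartition_coord (p : PartitionOfUnity V Z) (hp : ∀ z, p.finsupport z ∈ K) (z : Z) (v : V) :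
    (ofPartition p hp z).coord v = p v z := rfl

theorem finsupport_lerp_mem [DecidableEq V] {p q : PartitionOfUnity V Z}
    (h : ∀ z, p.finsupport z ∪ q.finsupport z ∈ K) (x : I × Z) : (p.lerp q).finsupport x ∈ K :=
  AbstractSimplicialComplex.mem_of_subset (h x.2) (p.finsupport_lerp_subset q x)
    (PartitionOfUnity.finsupport_nonempty _ x)

/-- Maps given by two partitions of unity are homotopic, along straight segments, when at each point
their supports lie in a common simplex. -/
theorem homotopic_ofPartition [DecidableEq V] {p q : PartitionOfUnity V Z}
    (hp : ∀ z, p.finsupport z ∈ K) (hq : ∀ z, q.finsupport z ∈ K)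
    (h : ∀ z, p.finsupport z ∪ q.finsupport z ∈ K) :
    (ofPartition p hp).Homotopic (ofPartition q hq) :=
  ⟨{ toContinuousMap := ofPartition (p.lerp q) (finsupport_lerp_mem h)
     map_zero_left := fun z => by
      ext v
      simp [PartitionOfUnity.lerp_apply]
     map_one_left := fun z => by
      ext v
      simp [PartitionOfUnity.lerp_apply] }⟩

/-! ### A locally finite approximation of the identity -/

theorem continuous_coord (v : V) : Continuous fun x : GeometricRealization K => x.coord v :=
  continuous_iff.2 fun _ => (continuous_apply v).comp continuous_subtype_val

/-- The sum of the squares of the barycentric coordinates. -/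
noncomputable def sumSq (x : GeometricRealization K) : ℝ := ∑ᶠ v, x.coord v ^ 2

theorem sumSq_eq_sum {x : GeometricRealization K} {s : Finset V} (hx : x.coord ∈ closedSimplex s) :
    sumSq x = ∑ v ∈ s, x.coord v ^ 2 :=
  finsum_eq_sum_of_support_subset _ fun v hv => by_contra fun h => hv (by simp [hx.2.1 v h])

theorem continuous_sumSq : Continuous (sumSq : GeometricRealization K → ℝ) := by
  refine continuous_iff.2 fun s => ?_
  have : sumSq ∘ simplexInclusion s = fun x => ∑ v ∈ s.1, x.1 v ^ 2 :=
    funext fun x => sumSq_eq_sum (x := simplexInclusion s x) x.2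
  rw [this]
  exact continuous_finsetSum _ fun v _ =>
    ((continuous_apply v).comp continuous_subtype_val).pow 2

theorem sumSq_pos (x : GeometricRealization K) : 0 < sumSq x := by
  obtain ⟨s, -, hx⟩ := x.exists_face
  rw [sumSq_eq_sum hx]
  obtain ⟨v, hv, h0⟩ := Finset.exists_ne_zero_of_sum_ne_zero (hx.2.2.trans_ne one_ne_zero)
  exact Finset.sum_pos' (fun v _ => sq_nonneg _) ⟨v, hv, by positivity⟩

/-- The sum of squares is a weighted mean of the coordinates, so some coordinate reaches it. -/
theorem exists_sumSq_le_coord (x : GeometricRealization K) : ∃ v, sumSq x ≤ x.coord v := by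
  obtain ⟨s, -, hx⟩ := x.exists_face
  by_contra! h
  have h1 : ∑ v ∈ s, x.coord v * x.coord v < ∑ v ∈ s, x.coord v * sumSq x := by
    obtain ⟨v, hv, h0⟩ := Finset.exists_ne_zero_of_sum_ne_zero (hx.2.2.trans_ne one_ne_zero)
    refine Finset.sum_lt_sum (fun v _ => mul_le_mul_of_nonneg_left (h v).le (hx.1 v)) ⟨v, hv, ?_⟩
    exact mul_lt_mul_of_pos_left (h v) ((hx.1 v).lt_of_ne' h0)
  rw [← Finset.sum_mul, hx.2.2, one_mul, sumSq_eq_sum hx] at h1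
  simp [sq] at h1

theorem locallyFinite_half_sumSq_lt_coord :
    LocallyFinite fun v : V => {x : GeometricRealization K | sumSq x / 2 < x.coord v} := by
  intro x
  obtain ⟨s, hs, hx⟩ := x.exists_face
  -- Where the coordinates in `s` add up to more than `1 - sumSq / 2`, the others are small.
  refine ⟨{y | 1 - sumSq y / 2 < ∑ v ∈ s, y.coord v}, IsOpen.mem_nhds (isOpen_lt
    (by have := continuous_sumSq (K := K); fun_prop)
    (continuous_finsetSum _ fun v _ => continuous_coord v)) ?_, s.finite_toSet.subset ?_⟩
  · have := sumSq_pos x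
    rw [mem_ofPred_eq, hx.2.2]
    linarith
  · rintro v ⟨y, hyv, hys⟩
    rw [mem_ofPred_eq] at hyv hys
    by_contra hv
    classical
    obtain ⟨t, -, ht⟩ := y.exists_face
    have h1 : ∑ w ∈ insert v s, y.coord w ≤ ∑ w ∈ t, y.coord w := by
      rw [Finset.sum_subset (Finset.subset_union_right (s₁ := insert v s)) fun w _ h => ht.2.1 w h]
      exact Finset.sum_le_sum_of_subset_of_nonneg Finset.subset_union_left fun w _ _ => ht.1 w
    rw [Finset.sum_insert hv, ht.2.2] at h1
    linarith

variable (K) in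
/-- The partition of unity on `|K|` obtained by cutting off the small barycentric coordinates. The
barycentric coordinates themselves need not be locally finite; these truncated ones are. -/
noncomputable def truncatedCoord : PartitionOfUnity V (GeometricRealization K) :=
  PartitionOfUnity.truncate (fun v => ⟨fun x => x.coord v, continuous_coord v⟩)
    ⟨fun x => sumSq x / 2, continuous_sumSq.div_const 2⟩ locallyFinite_half_sumSq_lt_coord
    fun x => by
      obtain ⟨v, hv⟩ := exists_sumSq_le_coord x
      exact ⟨v, (half_lt_self (sumSq_pos x)).trans_le hv⟩

theorem coord_ne_zero_of_truncatedCoord_ne_zero {x : GeometricRealization K} {v : V}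
    (h : truncatedCoord K v x ≠ 0) : x.coord v ≠ 0 :=
  ((half_pos (sumSq_pos x)).trans (PartitionOfUnity.lt_of_truncate_ne_zero h)).ne'

/-- Truncation moves every point within each closed simplex that contains it. -/
theorem finsupport_truncatedCoord_subset {x : GeometricRealization K} {s : Finset V}
    (hx : x.coord ∈ closedSimplex s) : (truncatedCoord K).finsupport x ⊆ s := fun v hv =>
  by_contra fun h => coord_ne_zero_of_truncatedCoord_ne_zero
    ((PartitionOfUnity.mem_finsupport _ _).1 hv) (hx.2.1 v h)

theorem finsupport_truncatedCoord_mem (x : GeometricRealization K) :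
    (truncatedCoord K).finsupport x ∈ K := by
  obtain ⟨s, hs, hx⟩ := x.exists_face
  exact AbstractSimplicialComplex.mem_of_subset hs (finsupport_truncatedCoord_subset hx)
    (PartitionOfUnity.finsupport_nonempty _ x)

/-- A family of maps `I → |K|` depending on `x : |K|` is jointly continuous as soon as it is so on
each closed simplex; this uses that `I` is locally compact. -/
theorem continuous_prod_of_simplices {f : GeometricRealization K → I → Y}
    (h : ∀ s : {s : Finset V // s ∈ K},
      Continuous fun x : closedSimplex s.1 × I => f (simplexInclusion s x.1) x.2) :
    Continuous fun x : GeometricRealization K × I => f x.1 x.2 := by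
  have hf : ∀ x, Continuous (f x) := fun x => by
    obtain ⟨s, y, rfl⟩ := exists_eq_simplexInclusion x
    exact (h s).comp (f := fun t => (y, t)) (by fun_prop)
  have hF : Continuous fun x => (⟨f x, hf x⟩ : C(I, Y)) :=
    continuous_iff.2 fun s => (ContinuousMap.curry ⟨_, h s⟩).continuous
  exact ContinuousMap.continuous_uncurry_of_continuous ⟨_, hF⟩

theorem homotopic_ofPartition_truncatedCoord_id :
    (ofPartition (truncatedCoord K) finsupport_truncatedCoord_mem).Homotopic
      (ContinuousMap.id (GeometricRealization K)) := by
  classical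
  have hmem : ∀ (s : {s : Finset V // s ∈ K}) (x : closedSimplex s.1),
      ((truncatedCoord K).compContinuous ⟨_, continuous_simplexInclusion s⟩).finsupport x ∪
        (simplexPartition s.1).finsupport x ∈ K := fun s x => by
    refine AbstractSimplicialComplex.mem_of_subset s.2 (Finset.union_subset ?_
      (finsupport_simplexPartition_subset s.1 x))
      ((PartitionOfUnity.finsupport_nonempty _ x).mono Finset.subset_union_right)
    rw [PartitionOfUnity.finsupport_compContinuous]
    exact finsupport_truncatedCoord_subset (x := simplexInclusion s x) x.2
  -- The straight-line homotopy on each closed simplex; these agree on common faces.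
  let H := fun s : {s : Finset V // s ∈ K} => ofPartition (PartitionOfUnity.lerp
    ((truncatedCoord K).compContinuous ⟨_, continuous_simplexInclusion s⟩)
    (simplexPartition s.1)) (finsupport_lerp_mem (hmem s))
  have hface : ∀ (x : GeometricRealization K) (t : I), ∃ s ∈ K,
      (fun v => (1 - (t : ℝ)) * truncatedCoord K v x + t * x.coord v) ∈ closedSimplex s := by
    intro x t
    obtain ⟨s, y, rfl⟩ := exists_eq_simplexInclusion x
    exact (H s (t, y)).exists_face
  have hcont := continuous_prod_of_simplices
    (f := fun x t => (⟨_, hface x t⟩ : GeometricRealization K))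
    fun s => (H s).continuous.comp continuous_swap
  exact ⟨{ toFun := fun x => ⟨_, hface x.2 x.1⟩
           continuous_toFun := hcont.comp continuous_swap
           map_zero_left := fun x => by
            ext v
            simp
           map_one_left := fun x => by
            ext v
            simp }⟩

end GeometricRealization

end Realization

/-! ### Open neighbourhoods of subcomplexes -/

section Neighbourhood

open Set Function Topology Filter

namespace PartitionOfUnity

variable {A Z : Type*} [TopologicalSpace Z]

/-- A measure of how far the point with barycentric coordinates `p · z` is from the subcomplex `Ω`: the
sum, over the nonempty finite sets `s` that are not faces of `Ω`, of the least coordinate at a vertex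
of `s`. The largest of these summands would do as well, but the continuity of a locally finite sum
is more readily available. -/
noncomputable def excess (p : PartitionOfUnity A Z) (Ω : PreAbstractSimplicialComplex A) (z : Z) :
    ℝ :=
  ∑ᶠ s : {s : Finset A // s.Nonempty ∧ s ∉ Ω}, s.1.inf' s.2.1 fun a => p a z

variable (p : PartitionOfUnity A Z) (Ω : PreAbstractSimplicialComplex A)

theorem inf'_nonneg (z : Z) {s : Finset A} (hs : s.Nonempty) : 0 ≤ s.inf' hs fun a => p a z :=
  Finset.le_inf' _ _ fun a _ => p.nonneg a z

theorem subset_of_inf'_ne_zero {z : Z} {s F : Finset A} (hs : s.Nonempty)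
    (hF : ∀ a ∉ F, p a z = 0) (h : s.inf' hs (fun a => p a z) ≠ 0) : s ⊆ F := fun a ha =>
  by_contra fun haF => h <| le_antisymm
    ((Finset.inf'_le _ ha).trans_eq (hF a haF)) (p.inf'_nonneg z hs)

theorem locallyFinite_support_inf' :
    LocallyFinite fun s : {s : Finset A // s.Nonempty ∧ s ∉ Ω} =>
      support fun z => s.1.inf' s.2.1 fun a => p a z := by
  intro z
  obtain ⟨F, hF⟩ := p.exists_finset_eventually_eq_zero z
  refine ⟨_, hF, (F.powerset.finite_toSet.preimage Subtype.val_injective.injOn).subset ?_⟩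
  rintro s ⟨y, hs, hy⟩
  exact Finset.mem_coe.2 (Finset.mem_powerset.2 (p.subset_of_inf'_ne_zero s.2.1 hy hs))

theorem continuous_excess : Continuous (p.excess Ω) :=
  continuous_finsum (fun s => Continuous.finset_inf'_apply s.2.1 fun a _ => (p a).continuous)
    (p.locallyFinite_support_inf' Ω)

theorem excess_nonneg (z : Z) : 0 ≤ p.excess Ω z :=
  finsum_nonneg fun s => p.inf'_nonneg z s.2.1

variable {p Ω}

/-- The vertices at which the coordinate exceeds the excess span a face of `Ω`: otherwise the least of
these coordinates would be one of the summands of the excess. -/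
theorem mem_of_excess_lt {z : Z} {s : Finset A} (hs : s.Nonempty)
    (h : ∀ a ∈ s, p.excess Ω z < p a z) : s ∈ Ω := by
  by_contra hΩ
  have h1 : s.inf' hs (fun a => p a z) ≤ p.excess Ω z :=
    single_le_finsum (f := fun s : {s : Finset A // s.Nonempty ∧ s ∉ Ω} =>
      s.1.inf' s.2.1 fun a => p a z) ⟨s, hs, hΩ⟩
      ((p.locallyFinite_support_inf' Ω).point_finite z) fun s => p.inf'_nonneg z s.2.1
  exact h1.not_gt ((Finset.lt_inf'_iff hs).2 h)

theorem excess_eq_zero {z : Z} (h : p.finsupport z ∈ Ω) : p.excess Ω z = 0 := by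
  refine (finsum_congr fun s => ?_).trans finsum_zero
  by_contra h0
  refine s.2.2 ((Ω.isRelLowerSet_faces h).2 (p.subset_of_inf'_ne_zero s.2.1 ?_ h0) s.2.1)
  exact fun a ha => by simpa using ha

variable (p Ω) in
/-- The open set of points some coordinate of which exceeds `excess p Ω`. It contains the points whose
support is a face of `Ω`. -/
def nhdsSubcomplex : Set Z := {z | ∃ a, p.excess Ω z < p a z}

theorem isOpen_nhdsSubcomplex : IsOpen (p.nhdsSubcomplex Ω) := by
  simp only [nhdsSubcomplex, ofPred_exists]
  exact isOpen_iUnion fun a => isOpen_lt (p.continuous_excess Ω) (p a).continuous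

theorem mem_nhdsSubcomplex {z : Z} (h : p.finsupport z ∈ Ω) : z ∈ p.nhdsSubcomplex Ω := by
  obtain ⟨a, ha⟩ := p.exists_pos (mem_univ z)
  exact ⟨a, (excess_eq_zero h).trans_lt ha⟩

variable (p Ω) in
/-- The retraction of the coordinates to the subcomplex `Ω`: the excess is subtracted from every
coordinate, and the result is normalised. -/
noncomputable def retract : PartitionOfUnity {a : A // {a} ∈ Ω} (p.nhdsSubcomplex Ω) :=
  truncate (fun a => ⟨fun z => p a.1 z, by fun_prop⟩)
    ⟨fun z => p.excess Ω z, (p.continuous_excess Ω).comp continuous_subtype_val⟩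
    (((p.locallyFinite.comp_injective (Subtype.val_injective (p := fun a => {a} ∈ Ω))
      ).preimage_continuous continuous_subtype_val).subset fun _ z hz =>
        ((p.excess_nonneg Ω z).trans_lt hz).ne')
    fun z => by
      obtain ⟨a, ha⟩ := z.2
      exact ⟨⟨a, mem_of_excess_lt (Finset.singleton_nonempty a) (by simpa using ha)⟩, ha⟩

theorem excess_lt_of_retract_ne_zero {a : {a : A // {a} ∈ Ω}} {z : p.nhdsSubcomplex Ω}
    (h : p.retract Ω a z ≠ 0) : p.excess Ω z < p a.1 z :=
  lt_of_truncate_ne_zero h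

theorem ne_zero_of_retract_ne_zero {a : {a : A // {a} ∈ Ω}} {z : p.nhdsSubcomplex Ω}
    (h : p.retract Ω a z ≠ 0) : p a.1 z ≠ 0 :=
  ((p.excess_nonneg Ω z).trans_lt (excess_lt_of_retract_ne_zero h)).ne'

theorem finsupport_retract_mem (z : p.nhdsSubcomplex Ω) :
    (p.retract Ω).finsupport z ∈ Ω.toComplex := by
  change Finset.map _ _ ∈ Ω
  refine mem_of_excess_lt (p := p) (z := z) (Finset.map_nonempty.2 (finsupport_nonempty _ z)) fun a ha => ?_
  obtain ⟨b, hb, rfl⟩ := Finset.mem_map.1 ha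
  exact excess_lt_of_retract_ne_zero ((mem_finsupport _ _).1 hb)

end PartitionOfUnity

end Neighbourhood

/-! ### Contiguity and homotopy -/

section Contiguity

open Set Function Topology Filter

universe u v

variable {V : Type u} {W : Type v} {Z : Type*} [TopologicalSpace Z]
  {K : AbstractSimplicialComplex V} {n : ℕ}

open GeometricRealization PartitionOfUnity

/-- Simplicial maps to `K ^ n` in the same contiguity class, evaluated at barycentric coordinates `p`
and followed by a projection, induce homotopic maps to `|K|`. -/
theorem SameContiguityClass.homotopic {L : AbstractSimplicialComplex W}
    {φ ψ : SimplicialMap L (K.power n)} (h : SameContiguityClass φ ψ) (p : PartitionOfUnity W Z)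
    (hp : ∀ z, p.finsupport z ∈ L) (i : Fin n)
    (hmem : ∀ (φ : SimplicialMap L (K.power n)) (z : Z),
      (p.mapIndex fun a => φ.toFun a i).finsupport z ∈ K) :
    (ofPartition (p.mapIndex fun a => φ.toFun a i) (hmem φ)).Homotopic
      (ofPartition (p.mapIndex fun a => ψ.toFun a i) (hmem ψ)) := by
  classical
  induction h with
  | refl => exact .refl _
  | @tail φ' ψ' _ h ih =>
    refine ih.trans (homotopic_ofPartition _ _ fun z => ?_)
    refine AbstractSimplicialComplex.mem_of_subset ((h _ (hp z)).2 i) (Finset.union_subset ?_ ?_)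
      ((finsupport_nonempty _ z).mono Finset.subset_union_left)
    · refine (finsupport_mapIndex_subset _ _ z).trans fun v hv => ?_
      simp only [Finset.mem_image, Finset.mem_union] at hv ⊢
      obtain ⟨a, ha, rfl⟩ := hv
      exact ⟨_, .inl ⟨a, ha, rfl⟩, rfl⟩
    · refine (finsupport_mapIndex_subset _ _ z).trans fun v hv => ?_
      simp only [Finset.mem_image, Finset.mem_union] at hv ⊢
      obtain ⟨a, ha, rfl⟩ := hv
      exact ⟨_, .inr ⟨a, ha, rfl⟩, rfl⟩

theorem SimplicialMap.finsupport_mapIndex_mem {L : AbstractSimplicialComplex W}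
    (φ : SimplicialMap L (K.power n)) {p : PartitionOfUnity W Z}
    (hp : ∀ z, p.finsupport z ∈ L) (i : Fin n) (z : Z) :
    (p.mapIndex fun a => φ.toFun a i).finsupport z ∈ K := by
  classical
  refine AbstractSimplicialComplex.mem_of_subset ((φ.map_face _ (hp z)).2 i)
    ((finsupport_mapIndex_subset _ _ z).trans_eq ?_) (finsupport_nonempty _ z)
  ext v
  simp

variable (K n) in
/-- The barycentric coordinates of the canonical map from `|K| ^ n`, with the product topology, to
`|K ^ n|`: products of truncated coordinates. -/
noncomputable def powerPartition :
    PartitionOfUnity (Fin n → V) (Fin n → GeometricRealization K) :=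
  PartitionOfUnity.pi fun i => (truncatedCoord K).compContinuous ⟨fun x => x i, continuous_apply i⟩

theorem truncatedCoord_ne_zero_of_powerPartition_ne_zero {a : Fin n → V}
    {x : Fin n → GeometricRealization K} (h : powerPartition K n a x ≠ 0) (i : Fin n) :
    truncatedCoord K (a i) (x i) ≠ 0 :=
  ne_zero_of_pi_ne_zero h i

theorem finsupport_powerPartition_mem (x : Fin n → GeometricRealization K) :
    (powerPartition K n).finsupport x ∈ K.power n := by
  classical
  refine ⟨finsupport_nonempty _ x, fun i => AbstractSimplicialComplex.mem_of_subset
    (finsupport_truncatedCoord_mem (x i)) ?_ ((finsupport_nonempty _ x).image _)⟩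
  intro v hv
  obtain ⟨a, ha, rfl⟩ := Finset.mem_image.1 hv
  exact (mem_finsupport _ _).2
    (truncatedCoord_ne_zero_of_powerPartition_ne_zero ((mem_finsupport _ _).1 ha) i)

/-- Over the open neighbourhood of a Farber subcomplex the coordinate projections to `|K|` are all
homotopic to one map. -/
theorem IsFarberSubcomplex.exists_homotopic {Ω : PreAbstractSimplicialComplex (Fin n → V)}
    (h : IsFarberSubcomplex K n Ω) :
    ∃ r : C((powerPartition K n).nhdsSubcomplex Ω, GeometricRealization K),
      ∀ i, r.Homotopic ⟨fun x => x.1 i, (continuous_apply i).comp continuous_subtype_val⟩ := by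
  classical
  obtain ⟨hΩ, τ, hτ⟩ := h
  set R := (powerPartition K n).retract Ω
  have hR : ∀ z, R.finsupport z ∈ Ω.toComplex := finsupport_retract_mem
  have hmem : ∀ (i : Fin n) (φ : SimplicialMap Ω.toComplex (K.power n)) z,
      (R.mapIndex fun a => φ.toFun a i).finsupport z ∈ K :=
    fun i φ z => φ.finsupport_mapIndex_mem hR i z
  have hτR : ∀ z, (R.mapIndex τ.toFun).finsupport z ∈ K := fun z =>
    AbstractSimplicialComplex.mem_of_subset (τ.map_face _ (hR z))
      (by convert! finsupport_mapIndex_subset _ _ z) (finsupport_nonempty _ z)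
  refine ⟨ofPartition (R.mapIndex τ.toFun) hτR, fun i => ?_⟩
  -- The coordinates of `Δ ∘ τ` are all equal to `τ`.
  have h1 : (ofPartition (R.mapIndex τ.toFun) hτR).Homotopic
      (ofPartition (R.mapIndex fun a => (subcomplexInclusion hΩ).toFun a i) (hmem i _)) :=
    hτ.homotopic R hR i (hmem i)
  let e : C((powerPartition K n).nhdsSubcomplex Ω, GeometricRealization K) :=
    ⟨fun x => x.1 i, (continuous_apply i).comp continuous_subtype_val⟩
  have h2 : (ofPartition (R.mapIndex fun a => (subcomplexInclusion hΩ).toFun a i)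
      (hmem i _)).Homotopic (ofPartition ((truncatedCoord K).compContinuous e) fun z => by
        rw [finsupport_compContinuous]; exact finsupport_truncatedCoord_mem _) := by
    refine homotopic_ofPartition _ _ fun z => ?_
    rw [finsupport_compContinuous, Finset.union_eq_right.2]
    · exact finsupport_truncatedCoord_mem _
    · intro v hv
      obtain ⟨a, rfl, ha⟩ := exists_of_mapIndex_ne_zero ((mem_finsupport _ _).1 hv)
      exact (mem_finsupport _ _).2 (truncatedCoord_ne_zero_of_powerPartition_ne_zero
        (ne_zero_of_retract_ne_zero ha) i)
  exact (h1.trans h2).trans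
    (homotopic_ofPartition_truncatedCoord_id.comp (ContinuousMap.Homotopic.refl e))

end Contiguity

/-! ### Sections of the endpoint map -/

section Sections

/-- Homotopies from one map to the coordinate projections assemble to a section of the endpoint
map. -/
theorem exists_section_endpointMap {n : ℕ} {X : Type*} [TopologicalSpace X] {U : Set (Fin n → X)}
    {r : C(U, X)}
    (h : ∀ i, r.Homotopic ⟨fun x => x.1 i, (continuous_apply i).comp continuous_subtype_val⟩) :
    ∃ s : C(U, WedgePathSpace n X), ∀ b : U, endpointMap n X (s b) = b := by
  have H := fun i => (h i).some
  refine ⟨⟨fun x => ⟨fun i => ((H i).toContinuousMap.comp ContinuousMap.prodSwap).curry x,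
    fun i j => ((H i).map_zero_left x).trans ((H j).map_zero_left x).symm⟩, ?_⟩,
    fun b => funext fun i => (H i).map_one_left b⟩
  exact Continuous.subtype_mk (continuous_pi fun i => ContinuousMap.continuous _) _

end Sections

theorem mainTheorem7 {V : Type*} (K : AbstractSimplicialComplex V) (n : ℕ) (hn : 1 ≤ n) :
    topologicalTC n (GeometricRealization K) ≤ discreteTC K n := by
  refine le_iInf₂ fun k hk => iInf₂_le k ?_
  obtain ⟨Ω, hΩ, hcover⟩ := hk
  refine ⟨fun j => (powerPartition K n).nhdsSubcomplex (Ω j),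
    fun j => PartitionOfUnity.isOpen_nhdsSubcomplex, ?_, fun j => ?_⟩
  · refine Set.iUnion_eq_univ_iff.2 fun x => ?_
    obtain ⟨j, hj⟩ := hcover _ (finsupport_powerPartition_mem x)
    exact ⟨j, PartitionOfUnity.mem_nhdsSubcomplex hj⟩
  · obtain ⟨r, hr⟩ := (hΩ j).exists_homotopic
    exact exists_section_endpointMap hr
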